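/- Let $f:[0,1]\to[0,1]$ be Borel measurable. Let $(X_k,Y_k)_{k\ge 1}$ be, under the probability measure $P_f$, i.i.d. pairs with $X_k$ uniformly distributed on $[0,1]$ and $Y_k\in\{0,1\}$ Bernoulli with mean $f(x)$ given $X_k=x$; write $(\mathbf X,\mathbf Y)_n$ for the first $n$ pairs. A split-point vector of size $m\ge 0$ is a (not necessarily ordered) vector $\mathbf u\in[0,1]^m$; with $u_{(1)}\le\dots\le u_{(m)}$ its ordered entries, it partitions $[0,1]$ into the $m+1$ cells $J_0=[0,u_{(1)}]$, $J_1=(u_{(1)},u_{(2)}]$, …, $J_m=(u_{(m)},1]$ (for $m=0$ the only cell is $[0,1]$). Let $\bar f_{\mathbf u}$ be the step function equal on each cell $J_i$ with $|J_i|>0$ to $|J_i|^{-1}\int_{J_i}f$. For a data set of $n$ pairs let $N_i^S$ and $N_i^F$ be the numbers of pairs with covariate in $J_i$ and response $1$, respectively $0$, and let $$Z_{\mathbf u}=\int_{[0,1]^{m+1}}\prod_{i=0}^m w_i^{N_i^S}(1-w_i)^{N_i^F}\,d\mathbf w .$$ The $Q_{\mathbf u}$-posterior $Q_{\mathbf u}(\cdot\mid(\mathbf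 X,\mathbf Y)_n)$ is the law of the random step function taking the value $w_i$ on $J_i$ $(0\le i\le m)$, where $\mathbf w$ has density $Z_{\mathbf u}^{-1}\prod_{i=0}^m w_i^{N_i^S}(1-w_i)^{N_i^F}$ on $[0,1]^{m+1}$ (the posterior under independent uniform step heights). For measurable $g:[0,1]\to[0,1]$ put $H(g)=\int_0^1\bigl[-g\log g-(1-g)\log(1-g)\bigr]dx$ with $0\log 0=0$. Then for each $\delta>0$ there exists $\varepsilon>0$ such that, for all sufficiently large $n$, the $P_f$-probability is at least $1-\delta$ that, simultaneously for all integers $0\le m\le\varepsilon n$ and all split-point vectors $\mathbf u$ of size $m$, $$Q_{\mathbf u}\bigl(\{g:\|g-\bar f_{\mathbf u}\|_1\ge\delta\}\mid(\mathbf X,\mathbf Y)_n\bigr)<\delta \qquad\text{and}\qquad \Bigl|\tfrac1n\log Z_{\mathbf u}\bigl((\mathbf X,\mathbf Y)_n\bigr)+H(\bar f_{\mathbf u})\Bigr|<\delta .$$ -/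

import Mathlib

open MeasureTheory ProbabilityTheory

noncomputable section

namespace BinaryRegression

/-- `(X k, Y k)`, `k = 0, 1, 2, …`, is a data stream for the regression function `f` under `P`:
the pairs are independent, each covariate `X k` is uniform on `[0, 1]`, and, given `X k`,
the response `Y k` (`true` is a success, `false` a failure) is Bernoulli with mean `f (X k)`. -/
structure IsDataStream {Ω : Type*} [MeasurableSpace Ω] (P : Measure Ω)
    (f : unitInterval → unitInterval) (X : ℕ → Ω → unitInterval) (Y : ℕ → Ω → Bool) : Prop where
  measurable_X : ∀ k, Measurable (X k)
  measurable_Y : ∀ k, Measurable (Y k)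
  indep : iIndepFun (fun k ω => (X k ω, Y k ω)) P
  uniform : ∀ k, P.map (X k) = volume
  bernoulli : ∀ k,
    P[fun ω => if Y k ω = true then (1 : ℝ) else 0 | MeasurableSpace.comap (X k) inferInstance]
      =ᵐ[P] fun ω => (f (X k ω) : ℝ)

/-- The data set consisting of the first `n` pairs of a stream. -/
def firstData {Ω : Type*} (X : ℕ → Ω → unitInterval) (Y : ℕ → Ω → Bool) (n : ℕ) (ω : Ω) :
    Fin n → unitInterval × Bool :=
  fun k => (X k ω, Y k ω)

/-- The index of the cell containing `t`: the number of split points lying strictly below `t`. -/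
def cellIndex {m : ℕ} (u : Fin m → unitInterval) (t : unitInterval) : Fin (m + 1) :=
  ⟨(Finset.univ.filter fun j => u j < t).card,
    Nat.lt_succ_of_le ((Finset.card_filter_le _ _).trans (by simp))⟩

/-- The `m + 1` cells of the partition of `[0, 1]` induced by a (not necessarily ordered) vector
of split points. If `u₍₁₎ ≤ ⋯ ≤ u₍ₘ₎` are the ordered split points, they are
`[0, u₍₁₎], (u₍₁₎, u₍₂₎], …, (u₍ₘ₎, 1]`. -/
def cell {m : ℕ} (u : Fin m → unitInterval) (i : Fin (m + 1)) : Set unitInterval :=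
  {t | cellIndex u t = i}

/-- The step function with value `w i` on the `i`-th cell. -/
def stepFunction {m : ℕ} (u : Fin m → unitInterval) (w : Fin (m + 1) → unitInterval) :
    unitInterval → ℝ :=
  fun t => w (cellIndex u t)

/-- The step function whose value on each cell is the mean value of `f` on that cell. -/
def cellAverage {m : ℕ} (f : unitInterval → unitInterval) (u : Fin m → unitInterval) :
    unitInterval → ℝ :=
  fun t => ⨍ s in cell u (cellIndex u t), (f s : ℝ)

open Classical in
/-- The number of successes with covariate in `J`. -/
def successCount {n : ℕ} (d : Fin n → unitInterval × Bool) (J : Set unitInterval) : ℕ :=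
  (Finset.univ.filter fun k => (d k).1 ∈ J ∧ (d k).2 = true).card

open Classical in
/-- The number of failures with covariate in `J`. -/
def failureCount {n : ℕ} (d : Fin n → unitInterval × Bool) (J : Set unitInterval) : ℕ :=
  (Finset.univ.filter fun k => (d k).1 ∈ J ∧ (d k).2 = false).card

/-- The likelihood of the data as a function of the step heights. -/
def likelihood {m n : ℕ} (u : Fin m → unitInterval) (d : Fin n → unitInterval × Bool)
    (w : Fin (m + 1) → unitInterval) : ℝ :=
  ∏ i, (w i : ℝ) ^ successCount d (cell u i) * (1 - (w i : ℝ)) ^ failureCount d (cell u i)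

/-- `likelihood` is the conditional probability of the responses given the covariates under the
regression function `stepFunction u w`. -/
theorem likelihood_eq {m n : ℕ} (u : Fin m → unitInterval) (d : Fin n → unitInterval × Bool)
    (w : Fin (m + 1) → unitInterval) :
    likelihood u d w =
      ∏ k, if (d k).2 = true then stepFunction u w (d k).1 else 1 - stepFunction u w (d k).1 := by
  classical
  rw [← Finset.prod_fiberwise (s := Finset.univ) (g := fun k => cellIndex u (d k).1)]
  unfold likelihood
  refine Finset.prod_congr rfl fun i _ => ?_
  rw [Finset.prod_ite]
  congr 1
  · rw [Finset.prod_congr rfl (g := fun _ => (w i : ℝ)), Finset.prod_const]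
    · unfold successCount
      congr 2
      ext k
      simp only [Finset.mem_filter, Finset.mem_univ, true_and]
      exact Iff.rfl
    · intro k hk
      simp only [Finset.mem_filter] at hk
      simp [stepFunction, hk.1.2]
  · rw [Finset.prod_congr rfl (g := fun _ => 1 - (w i : ℝ)), Finset.prod_const]
    · unfold failureCount
      congr 2
      ext k
      simp only [Finset.mem_filter, Finset.mem_univ, true_and, Bool.not_eq_true]
      exact Iff.rfl
    · intro k hk
      simp only [Finset.mem_filter] at hk
      simp [stepFunction, hk.1.2]

/-- The predictive probability of the data when the step heights are independent and uniform on
`[0, 1]` (`volume` is Lebesgue measure on the cube `[0, 1] ^ (m + 1)`). -/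
def predictive {m n : ℕ} (u : Fin m → unitInterval) (d : Fin n → unitInterval × Bool) : ℝ :=
  ∫ w : Fin (m + 1) → unitInterval, likelihood u d w

/-- The posterior law of the step heights: its density with respect to the uniform prior on the
cube is the likelihood divided by the predictive probability. -/
def heightPosterior {m n : ℕ} (u : Fin m → unitInterval) (d : Fin n → unitInterval × Bool) :
    Measure (Fin (m + 1) → unitInterval) :=
  volume.withDensity fun w => ENNReal.ofReal ((predictive u d)⁻¹ * likelihood u d w)

/-- The posterior probability that the random step function with split points `u` lies in `A`. -/
def posterior {m n : ℕ} (u : Fin m → unitInterval) (d : Fin n → unitInterval × Bool)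
    (A : Set (unitInterval → ℝ)) : ENNReal :=
  heightPosterior u d {w | stepFunction u w ∈ A}

/-- The `L¹` distance on `[0, 1]`. -/
def l1Dist (g h : unitInterval → ℝ) : ℝ :=
  ∫ t, |g t - h t|

/-- The entropy functional; `Real.binEntropy p = -p log p - (1 - p) log (1 - p)`. -/
def entropy (g : unitInterval → ℝ) : ℝ :=
  ∫ t, Real.binEntropy (g t)

end BinaryRegression

end

noncomputable section

namespace BinaryRegression

/-! Given the data, everything decouples over the cells: `likelihood` is a product of Beta kernels,
so `predictive` is a product of Beta integrals. With `N = S + F` the Beta integral lies between `exp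
(-N h(S/N)) / (N + 1)` and `exp (-N h(S/N))`, where `h` is the binary entropy, and the posterior
expectation of `(N w - S) ^ 2` is at most `N + 1`. The resulting costs of order `log (N_i + 1)` and
`N_i + 1` per cell sum to a small multiple of `n`, respectively to `n + m + 1`, when `m / n` is
small. Both assertions thus reduce to one fact: the empirical frequencies of successes and failures
in the cells are close to their true masses, summed over all cells (`cellDeviation`).

Uniformity in `u` comes from a fixed grid of `M` blocks with `M` about `γ n`. A block without a
split point lies in one cell, and at most `m` blocks, of mass at most `1 / M` each, contain one.
Hence `cellDeviation` is at most `gridDeviation` plus `2 m / M` for every `u` at once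
(`sum_cell_deviation_le`). The grid deviation does not involve `u`; its mean is of order `sqrt (M /
n)`, about `sqrt γ`, so it is small with high probability for small `γ` (`exists_grid`). Then `ε` is
taken small compared with `γ`. -/

/-! ### Beta integrals: second moment and entropy asymptotics. -/

/-- The Beta integral with natural exponents. -/
def betaInt (S F : ℕ) : ℝ := ∫ w : unitInterval, (w : ℝ) ^ S * (1 - (w : ℝ)) ^ F

theorem betaInt_eq (S F : ℕ) :
    betaInt S F = (S.factorial * F.factorial : ℝ) / ((S + F + 1).factorial : ℝ) := by
  have h1 : betaInt S F = ∫ x in (0 : ℝ)..1, x ^ S * (1 - x) ^ F := by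
    rw [intervalIntegral.integral_of_le zero_le_one, ← integral_Icc_eq_integral_Ioc]
    exact unitInterval.measurePreserving_coe.integral_comp
      unitInterval.measurableEmbedding_coe (fun x : ℝ => x ^ S * (1 - x) ^ F)
  have h2 : Complex.betaIntegral (S + 1) (F + 1) =
      ((∫ x in (0 : ℝ)..1, x ^ S * (1 - x) ^ F : ℝ) : ℂ) := by
    rw [Complex.betaIntegral, ← intervalIntegral.integral_ofReal]
    congr 1
    ext x
    simp [Complex.cpow_natCast]
  have h3 := Complex.betaIntegral_eq_Gamma_mul_div ((S : ℂ) + 1) ((F : ℂ) + 1)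
    (by simp; positivity) (by simp; positivity)
  rw [h2, Complex.Gamma_nat_eq_factorial, Complex.Gamma_nat_eq_factorial,
    show ((S : ℂ) + 1 + ((F : ℂ) + 1)) = ((S + F + 1 : ℕ) : ℂ) + 1 by push_cast; ring,
    Complex.Gamma_nat_eq_factorial] at h3
  rw [h1]
  apply Complex.ofReal_injective
  rw [h3]
  push_cast
  rfl

theorem betaInt_pos (S F : ℕ) : 0 < betaInt S F := by
  rw [betaInt_eq]
  positivity

theorem betaInt_succ_left (S F : ℕ) :
    betaInt (S + 1) F = (S + 1) / (S + F + 2) * betaInt S F := by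
  rw [betaInt_eq, betaInt_eq, show S + 1 + F + 1 = (S + F + 1) + 1 by ring,
    Nat.factorial_succ (S + F + 1), Nat.factorial_succ S]
  have := Nat.factorial_pos (S + F + 1)
  push_cast
  field_simp
  ring

theorem continuous_betaKernel (S F : ℕ) :
    Continuous fun w : unitInterval => (w : ℝ) ^ S * (1 - (w : ℝ)) ^ F := by
  fun_prop

theorem integrable_of_continuous_unitInterval {g : unitInterval → ℝ} (hg : Continuous g) :
    Integrable g :=
  hg.integrable_of_hasCompactSupport (HasCompactSupport.of_compactSpace g)

/-- Second moment of a Beta law around the empirical success fraction. -/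
theorem integral_sq_mul_betaKernel_le (S F : ℕ) :
    ∫ w : unitInterval, (((S + F : ℕ) : ℝ) * w - S) ^ 2 * ((w : ℝ) ^ S * (1 - (w : ℝ)) ^ F) ≤
      (((S + F : ℕ) : ℝ) + 1) * betaInt S F := by
  have hi : ∀ k, Integrable fun w : unitInterval => (w : ℝ) ^ k * (1 - (w : ℝ)) ^ F := fun k =>
    integrable_of_continuous_unitInterval (continuous_betaKernel k F)
  have h : ∫ w : unitInterval, (((S + F : ℕ) : ℝ) * w - S) ^ 2 *
      ((w : ℝ) ^ S * (1 - (w : ℝ)) ^ F) =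
      ((S + F : ℕ) : ℝ) ^ 2 * betaInt (S + 2) F - 2 * (S + F : ℕ) * S * betaInt (S + 1) F
        + (S : ℝ) ^ 2 * betaInt S F := by
    unfold betaInt
    rw [← integral_const_mul, ← integral_const_mul, ← integral_const_mul, ← integral_sub,
      ← integral_add]
    · congr 1
      ext w
      ring
    · exact ((hi _).const_mul _).sub ((hi _).const_mul _)
    · exact (hi _).const_mul _
    · exact (hi _).const_mul _
    · exact (hi _).const_mul _
  rw [h, betaInt_succ_left (S + 1) F, betaInt_succ_left S F]
  have hB := (betaInt_pos S F).le
  have hS : (0 : ℝ) ≤ S := Nat.cast_nonneg S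
  have hF : (0 : ℝ) ≤ F := Nat.cast_nonneg F
  push_cast
  have key : ((S : ℝ) + F) ^ 2 * ((S + 1 + 1) / (S + 1 + F + 2) * ((S + 1) / (S + F + 2))) -
      2 * (S + F) * S * ((S + 1) / (S + F + 2)) + (S : ℝ) ^ 2 ≤ S + F + 1 := by
    generalize (S : ℝ) = s at *
    generalize (F : ℝ) = t at *
    rw [← sub_nonneg]
    have : s + t + 1 - ((s + t) ^ 2 * ((s + 1 + 1) / (s + 1 + t + 2) * ((s + 1) / (s + t + 2))) -
      2 * (s + t) * s * ((s + 1) / (s + t + 2)) + s ^ 2) =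
      ((s + t + 1) * ((s + 1 + t + 2) * (s + t + 2)) - ((s + t) ^ 2 * ((s + 2) * (s + 1)) -
      2 * (s + t) * s * ((s + 1) * (s + 1 + t + 2)) + s ^ 2 * ((s + 1 + t + 2) * (s + t + 2))))
        / ((s + 1 + t + 2) * (s + t + 2)) := by
      field_simp
      ring
    rw [this]
    apply div_nonneg _ (by positivity)
    -- Once denominators are cleared, the difference is a polynomial in `s` and `t` with nonnegative
    -- coefficients.
    ring_nf
    nlinarith [mul_nonneg hS hF, mul_nonneg (mul_nonneg hS hF) hS, mul_nonneg (mul_nonneg hS hF) hF,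
      pow_nonneg hS 3, pow_nonneg hF 3]
  calc _ = (((S : ℝ) + F) ^ 2 * ((S + 1 + 1) / (S + 1 + F + 2) * ((S + 1) / (S + F + 2))) -
      2 * (S + F) * S * ((S + 1) / (S + F + 2)) + (S : ℝ) ^ 2) * betaInt S F := by ring
    _ ≤ _ := mul_le_mul_of_nonneg_right key hB

/-- The factor `N ^ N` removes all divisions, so the identity persists for vanishing counts, with `0
^ 0 = 1`. -/
theorem exp_neg_mul_binEntropy (S F : ℕ) :
    Real.exp (-(((S + F : ℕ) : ℝ) * Real.binEntropy (S / (S + F : ℕ)))) *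
      ((S + F : ℕ) : ℝ) ^ (S + F) = (S : ℝ) ^ S * (F : ℝ) ^ F := by
  rcases Nat.eq_zero_or_pos S with rfl | hS
  · simp
  rcases Nat.eq_zero_or_pos F with rfl | hF
  · have : (S : ℝ) ≠ 0 := by positivity
    simp [div_self this]
  have hS' : (0 : ℝ) < S := by positivity
  have hF' : (0 : ℝ) < F := by positivity
  have hN : (0 : ℝ) < ((S + F : ℕ) : ℝ) := by push_cast; positivity
  have e : ∀ {x : ℝ} (k : ℕ), 0 < x → x ^ k = Real.exp (k * Real.log x) := fun k hx => by
    rw [Real.exp_nat_mul, Real.exp_log hx]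
  have h1 : 1 - (S : ℝ) / (S + F : ℕ) = F / (S + F : ℕ) := by
    field_simp
    push_cast
    ring
  rw [e _ hN, e _ hS', e _ hF', ← Real.exp_add, ← Real.exp_add, Real.binEntropy, h1, inv_div,
    inv_div, Real.log_div hN.ne' hS'.ne', Real.log_div hN.ne' hF'.ne']
  congr 1
  have : ((S + F : ℕ) : ℝ) = S + F := by push_cast; ring
  rw [this] at hN ⊢
  field_simp
  ring

/-- This is `t ≤ exp (t - 1)` at `t = y / S`, raised to the power `S`. It replaces calculus in
maximising the Beta kernel. -/
theorem pow_le_pow_self_mul_exp {y : ℝ} (hy : 0 ≤ y) (S : ℕ) :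
    y ^ S ≤ (S : ℝ) ^ S * Real.exp (y - S) := by
  rcases Nat.eq_zero_or_pos S with rfl | hS
  · simpa using hy
  have hS' : (0 : ℝ) < S := by positivity
  have h : y / S ≤ Real.exp (y / S - 1) := by
    have := Real.add_one_le_exp (y / S - 1)
    linarith
  have h2 := pow_le_pow_left₀ (by positivity) h S
  rw [← Real.exp_nat_mul, div_pow, show (S : ℝ) * (y / S - 1) = y - S by field_simp,
    div_le_iff₀ (by positivity)] at h2
  linarith

/-- The kernel is largest at `w = S / N`. The previous bound is applied to `N w` and `N (1 - w)`;
the two exponents `N w - S` and `N (1 - w) - F` cancel. -/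
theorem betaKernel_le (S F : ℕ) {w : ℝ} (h0 : 0 ≤ w) (h1 : w ≤ 1) :
    w ^ S * (1 - w) ^ F ≤
      Real.exp (-(((S + F : ℕ) : ℝ) * Real.binEntropy (S / (S + F : ℕ)))) := by
  have hN : (0 : ℝ) < ((S + F : ℕ) : ℝ) ^ (S + F) := by
    rcases Nat.eq_zero_or_pos (S + F) with h | h
    · simp [h]
    · positivity
  refine le_of_mul_le_mul_right ?_ hN
  rw [exp_neg_mul_binEntropy]
  have hw : 0 ≤ 1 - w := by linarith
  have a := pow_le_pow_self_mul_exp (y := ((S + F : ℕ) : ℝ) * w) (by positivity) S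
  have b := pow_le_pow_self_mul_exp (y := ((S + F : ℕ) : ℝ) * (1 - w)) (by positivity) F
  have c := mul_le_mul a b (by positivity) (by positivity)
  calc w ^ S * (1 - w) ^ F * ((S + F : ℕ) : ℝ) ^ (S + F)
      = (((S + F : ℕ) : ℝ) * w) ^ S * (((S + F : ℕ) : ℝ) * (1 - w)) ^ F := by
        rw [mul_pow, mul_pow, pow_add]; ring
    _ ≤ _ := c
    _ = (S : ℝ) ^ S * (F : ℝ) ^ F * (Real.exp (((S + F : ℕ) : ℝ) * w - S) *
          Real.exp (((S + F : ℕ) : ℝ) * (1 - w) - F)) := by ring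
    _ = _ := by
        rw [← Real.exp_add, show ((S + F : ℕ) : ℝ) * w - S + (((S + F : ℕ) : ℝ) * (1 - w) - F) = 0
          by push_cast; ring]
        simp

theorem betaInt_le (S F : ℕ) :
    betaInt S F ≤ Real.exp (-(((S + F : ℕ) : ℝ) * Real.binEntropy (S / (S + F : ℕ)))) := by
  have := integral_mono (integrable_of_continuous_unitInterval (continuous_betaKernel S F))
    (integrable_const _) (fun w : unitInterval => betaKernel_le S F w.2.1 w.2.2)
  simpa [betaInt] using this

/-- Here `(N + 1) * betaInt S F` is the inverse of `N.choose S`, and `N.choose S * S ^ S * F ^ F` is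
a single term of the binomial expansion of `(S + F) ^ N`. -/
theorem le_betaInt (S F : ℕ) :
    Real.exp (-(((S + F : ℕ) : ℝ) * Real.binEntropy (S / (S + F : ℕ)))) ≤
      (((S + F : ℕ) : ℝ) + 1) * betaInt S F := by
  have hN : (0 : ℝ) < ((S + F : ℕ) : ℝ) ^ (S + F) := by
    rcases Nat.eq_zero_or_pos (S + F) with h | h
    · simp [h]
    · positivity
  refine le_of_mul_le_mul_right ?_ hN
  rw [exp_neg_mul_binEntropy, betaInt_eq]
  have h : ((S + F).choose S : ℝ) * ((S : ℝ) ^ S * (F : ℝ) ^ F) ≤ ((S + F : ℕ) : ℝ) ^ (S + F) := by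
    have : S ^ S * F ^ (S + F - S) * (S + F).choose S ≤ (S + F) ^ (S + F) := by
      rw [add_pow]
      exact Finset.single_le_sum (f := fun k => S ^ k * F ^ (S + F - k) * (S + F).choose k)
        (fun _ _ => Nat.zero_le _) (Finset.mem_range.2 (by omega))
    rw [Nat.add_sub_cancel_left] at this
    have := (Nat.cast_le (α := ℝ)).2 this
    push_cast at this ⊢
    linarith
  have hc : ((S + F).choose S : ℝ) * S.factorial * F.factorial = (S + F).factorial := by
    rw [Nat.choose_symm_add]
    exact_mod_cast Nat.add_choose_mul_factorial_mul_factorial S F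
  have hf : (((S + F : ℕ) : ℝ) + 1) * ((S.factorial * F.factorial : ℝ) / ((S + F + 1).factorial : ℝ))
      = ((S + F).choose S : ℝ)⁻¹ := by
    rw [Nat.factorial_succ, Nat.cast_mul, ← hc]
    have : ((S + F).choose S : ℝ) ≠ 0 := by
      exact_mod_cast (Nat.choose_pos (Nat.le_add_right S F)).ne'
    push_cast
    have : (S : ℝ) + F + 1 ≠ 0 := by positivity
    field_simp
  rw [hf]
  have hp : (0 : ℝ) < (S + F).choose S := by
    exact_mod_cast Nat.choose_pos (Nat.le_add_right S F)
  rw [inv_mul_eq_div, le_div_iff₀ hp]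
  linarith

theorem abs_log_betaInt_add_le (S F : ℕ) :
    |Real.log (betaInt S F) + ((S + F : ℕ) : ℝ) * Real.binEntropy (S / (S + F : ℕ))| ≤
      Real.log (((S + F : ℕ) : ℝ) + 1) := by
  have h1 := Real.log_le_log (betaInt_pos S F) (betaInt_le S F)
  have h2 := Real.log_le_log (Real.exp_pos _) (le_betaInt S F)
  rw [Real.log_mul (by positivity) (betaInt_pos S F).ne'] at h2
  rw [Real.log_exp] at h1 h2
  have h3 : 0 ≤ Real.log (((S + F : ℕ) : ℝ) + 1) := Real.log_nonneg (by simp; positivity)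
  rw [abs_le]
  constructor <;> linarith

/-! ### Factorisation over cells and Markov's inequality for the posterior. -/

section

open Classical in
/-- The number of pairs with covariate in `J` and response `y`. -/
def respCount {n : ℕ} (d : Fin n → unitInterval × Bool) (J : Set unitInterval) (y : Bool) : ℕ :=
  (Finset.univ.filter fun k => (d k).1 ∈ J ∧ (d k).2 = y).card

variable {m n : ℕ}

open Classical in
theorem respCount_eq_sum (d : Fin n → unitInterval × Bool) (J : Set unitInterval) (y : Bool) :
    (respCount d J y : ℝ) = ∑ k, if (d k).1 ∈ J ∧ (d k).2 = y then (1 : ℝ) else 0 := by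
  rw [respCount, Finset.card_filter]
  push_cast
  rfl

/-- Counting a set fibre by fibre. -/
theorem sum_respCount_inter_fiber {ι : Type*} [Fintype ι] [DecidableEq ι]
    (d : Fin n → unitInterval × Bool) (J : Set unitInterval) (y : Bool) (c : unitInterval → ι) :
    ∑ i, (respCount d (J ∩ {t | c t = i}) y : ℝ) = respCount d J y := by
  classical
  simp_rw [respCount_eq_sum]
  rw [Finset.sum_comm]
  refine Finset.sum_congr rfl fun k _ => ?_
  rw [Finset.sum_eq_single (c (d k).1)]
  · simp
  · intro i _ hi
    rw [if_neg]
    rintro ⟨⟨_, h⟩, _⟩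
    exact hi h.symm
  · simp

theorem respCount_univ_add (d : Fin n → unitInterval × Bool) :
    (respCount d Set.univ true : ℝ) + respCount d Set.univ false = n := by
  classical
  simp_rw [respCount_eq_sum]
  rw [← Finset.sum_add_distrib]
  trans ∑ _k : Fin n, (1 : ℝ)
  · refine Finset.sum_congr rfl fun k _ => ?_
    cases (d k).2 <;> simp
  · simp

theorem sum_cell_counts (u : Fin m → unitInterval) (d : Fin n → unitInterval × Bool) :
    ∑ i, ((respCount d (cell u i) true + respCount d (cell u i) false : ℕ) : ℝ) = n := by
  have h := fun y => sum_respCount_inter_fiber d Set.univ y (cellIndex u)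
  simp only [Set.univ_inter] at h
  push_cast
  rw [Finset.sum_add_distrib, ← respCount_univ_add d, ← h, ← h]
  rfl

theorem continuous_likelihood (u : Fin m → unitInterval) (d : Fin n → unitInterval × Bool) :
    Continuous (likelihood u d) := by
  unfold likelihood
  fun_prop

theorem likelihood_nonneg (u : Fin m → unitInterval) (d : Fin n → unitInterval × Bool)
    (w : Fin (m + 1) → unitInterval) : 0 ≤ likelihood u d w :=
  Finset.prod_nonneg fun i _ =>
    mul_nonneg (pow_nonneg (w i).2.1 _) (pow_nonneg (sub_nonneg.2 (w i).2.2) _)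

theorem predictive_eq_prod (u : Fin m → unitInterval) (d : Fin n → unitInterval × Bool) :
    predictive u d =
      ∏ i, betaInt (respCount d (cell u i) true) (respCount d (cell u i) false) := by
  unfold predictive likelihood betaInt
  exact integral_fintype_prod_volume_eq_prod
    (f := fun i (x : unitInterval) => (x : ℝ) ^ successCount d (cell u i) *
      (1 - (x : ℝ)) ^ failureCount d (cell u i))

theorem predictive_pos (u : Fin m → unitInterval) (d : Fin n → unitInterval × Bool) :
    0 < predictive u d := by
  rw [predictive_eq_prod]
  exact Finset.prod_pos fun i _ => betaInt_pos _ _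

/-- The logarithm of the predictive probability, up to a logarithmic error for each cell. -/
theorem abs_log_predictive_add_le (u : Fin m → unitInterval) (d : Fin n → unitInterval × Bool)
    (S N : Fin (m + 1) → ℕ) (hS : ∀ i, S i = respCount d (cell u i) true)
    (hN : ∀ i, N i = respCount d (cell u i) true + respCount d (cell u i) false) :
    |Real.log (predictive u d) + ∑ i, (N i : ℝ) * Real.binEntropy (S i / N i)| ≤
      ∑ i, Real.log ((N i : ℝ) + 1) := by
  rw [predictive_eq_prod, Real.log_prod (fun i _ => (betaInt_pos _ _).ne'),
    ← Finset.sum_add_distrib]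
  refine (Finset.abs_sum_le_sum_abs _ _).trans (Finset.sum_le_sum fun i _ => ?_)
  rw [hS, hN]
  exact abs_log_betaInt_add_le _ _

/-- The sum over the cells of the squared deviations of the expected from the observed numbers of
successes. -/
def sqDeviation (u : Fin m → unitInterval) (d : Fin n → unitInterval × Bool)
    (w : Fin (m + 1) → unitInterval) : ℝ :=
  ∑ i, (((respCount d (cell u i) true + respCount d (cell u i) false : ℕ) : ℝ) * w i -
    respCount d (cell u i) true) ^ 2

theorem continuous_sqDeviation (u : Fin m → unitInterval) (d : Fin n → unitInterval × Bool) :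
    Continuous (sqDeviation u d) := by
  unfold sqDeviation
  fun_prop

/-- The `i`-th summand changes only the `i`-th factor of the product integral, at the cost of a
factor at most `N_i + 1`; the counts `N_i` sum to `n`. -/
theorem integral_sqDeviation_mul_likelihood_le (u : Fin m → unitInterval)
    (d : Fin n → unitInterval × Bool) :
    ∫ w, sqDeviation u d w * likelihood u d w ≤ ((n : ℝ) + (m + 1)) * predictive u d := by
  set S : Fin (m + 1) → ℕ := fun i => respCount d (cell u i) true with hS
  set F : Fin (m + 1) → ℕ := fun i => respCount d (cell u i) false with hF
  have hterm : ∀ i, ∫ w : Fin (m + 1) → unitInterval,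
      (((S i + F i : ℕ) : ℝ) * w i - S i) ^ 2 * likelihood u d w ≤
        (((S i + F i : ℕ) : ℝ) + 1) * predictive u d := by
    intro i
    have h1 : ∀ w : Fin (m + 1) → unitInterval,
        (((S i + F i : ℕ) : ℝ) * w i - S i) ^ 2 * likelihood u d w =
        ∏ j, (if j = i then (((S j + F j : ℕ) : ℝ) * w j - S j) ^ 2 else 1) *
          ((w j : ℝ) ^ S j * (1 - (w j : ℝ)) ^ F j) := by
      intro w
      rw [Finset.prod_mul_distrib, Finset.prod_ite_eq' Finset.univ i, if_pos (Finset.mem_univ i)]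
      rfl
    simp_rw [h1]
    rw [integral_fintype_prod_volume_eq_prod (f := fun j (x : unitInterval) =>
      (if j = i then (((S j + F j : ℕ) : ℝ) * x - S j) ^ 2 else 1) *
          ((x : ℝ) ^ S j * (1 - (x : ℝ)) ^ F j)), predictive_eq_prod,
      ← Finset.mul_prod_erase Finset.univ _ (Finset.mem_univ i),
      ← Finset.mul_prod_erase Finset.univ
        (fun i => betaInt (respCount d (cell u i) true) (respCount d (cell u i) false))
        (Finset.mem_univ i), ← mul_assoc]
    have h2 : ∏ x ∈ Finset.univ.erase i, ∫ y : unitInterval,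
        (if x = i then (((S x + F x : ℕ) : ℝ) * y - S x) ^ 2 else 1) *
          ((y : ℝ) ^ S x * (1 - (y : ℝ)) ^ F x) =
        ∏ x ∈ Finset.univ.erase i, betaInt (S x) (F x) := by
      refine Finset.prod_congr rfl fun x hx => ?_
      simp [Finset.ne_of_mem_erase hx, betaInt]
    rw [h2]
    refine mul_le_mul_of_nonneg_right ?_ (Finset.prod_nonneg fun j _ => (betaInt_pos _ _).le)
    simpa using integral_sq_mul_betaKernel_le (S i) (F i)
  have hint : ∀ i, Integrable fun w : Fin (m + 1) → unitInterval =>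
      (((S i + F i : ℕ) : ℝ) * w i - S i) ^ 2 * likelihood u d w := by
    intro i
    have hc : Continuous fun w : Fin (m + 1) → unitInterval =>
        (((S i + F i : ℕ) : ℝ) * w i - S i) ^ 2 * likelihood u d w := by
      have := continuous_likelihood u d
      fun_prop
    exact hc.integrable_of_hasCompactSupport (HasCompactSupport.of_compactSpace _)
  calc ∫ w, sqDeviation u d w * likelihood u d w
      = ∑ i, ∫ w : Fin (m + 1) → unitInterval,
          (((S i + F i : ℕ) : ℝ) * w i - S i) ^ 2 * likelihood u d w := by
        rw [← integral_finsetSum _ fun i _ => hint i]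
        congr 1
        ext w
        rw [sqDeviation, Finset.sum_mul]
    _ ≤ ∑ i, (((S i + F i : ℕ) : ℝ) + 1) * predictive u d := Finset.sum_le_sum fun i _ => hterm i
    _ = _ := by
        rw [← Finset.sum_mul, Finset.sum_add_distrib, sum_cell_counts u d]
        simp

/-- Markov's inequality for the posterior. -/
theorem heightPosterior_sqDeviation_le (u : Fin m → unitInterval)
    (d : Fin n → unitInterval × Bool) {T : ℝ} (hT : 0 < T) :
    heightPosterior u d {w | T ≤ sqDeviation u d w} ≤
      ENNReal.ofReal (((n : ℝ) + (m + 1)) / T) := by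
  have hZ := predictive_pos u d
  have hcV := continuous_sqDeviation u d
  have hcL := continuous_likelihood u d
  have hmeas : MeasurableSet {w | T ≤ sqDeviation u d w} :=
    measurableSet_le measurable_const hcV.measurable
  have hnn : ∀ w, 0 ≤ (predictive u d)⁻¹ / T * (sqDeviation u d w * likelihood u d w) := fun w =>
    mul_nonneg (by positivity) (mul_nonneg (Finset.sum_nonneg fun i _ => sq_nonneg _)
      (likelihood_nonneg u d w))
  rw [heightPosterior, withDensity_apply _ hmeas]
  calc ∫⁻ w in {w | T ≤ sqDeviation u d w},
        ENNReal.ofReal ((predictive u d)⁻¹ * likelihood u d w)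
      ≤ ∫⁻ w in {w | T ≤ sqDeviation u d w},
        ENNReal.ofReal ((predictive u d)⁻¹ / T * (sqDeviation u d w * likelihood u d w)) := by
        refine setLIntegral_mono' hmeas fun w hw => ENNReal.ofReal_le_ofReal ?_
        rw [div_mul_eq_mul_div, mul_div_assoc]
        refine mul_le_mul_of_nonneg_left ?_ (by positivity)
        rw [le_div_iff₀ hT, mul_comm]
        exact mul_le_mul_of_nonneg_right hw (likelihood_nonneg u d w)
    _ ≤ ∫⁻ w, ENNReal.ofReal ((predictive u d)⁻¹ / T *
          (sqDeviation u d w * likelihood u d w)) := setLIntegral_le_lintegral _ _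
    _ = ENNReal.ofReal (∫ w, (predictive u d)⁻¹ / T *
          (sqDeviation u d w * likelihood u d w)) := by
        rw [ofReal_integral_eq_lintegral_ofReal _ (Filter.Eventually.of_forall hnn)]
        exact (by fun_prop : Continuous fun w => (predictive u d)⁻¹ / T *
          (sqDeviation u d w * likelihood u d w)).integrable_of_hasCompactSupport
          (HasCompactSupport.of_compactSpace _)
    _ ≤ _ := by
        refine ENNReal.ofReal_le_ofReal ?_
        rw [integral_const_mul]
        refine (mul_le_mul_of_nonneg_left (integral_sqDeviation_mul_likelihood_le u d)
          (by positivity)).trans_eq ?_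
        field_simp

end

/-! ### Cells against a fixed grid. -/

/-- The conditional probability of the response `y` at the covariate `t`. -/
def respProb (f : unitInterval → unitInterval) (y : Bool) (t : unitInterval) : ℝ :=
  if y = true then (f t : ℝ) else 1 - (f t : ℝ)

/-- The probability that a pair has covariate in `J` and response `y`. -/
def mass (f : unitInterval → unitInterval) (J : Set unitInterval) (y : Bool) : ℝ :=
  ∫ t in J, respProb f y t

theorem respProb_nonneg (f : unitInterval → unitInterval) (y : Bool) (t : unitInterval) :
    0 ≤ respProb f y t := by
  cases y
  · simpa [respProb] using (f t).2.2
  · simpa [respProb] using (f t).2.1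

theorem respProb_le_one (f : unitInterval → unitInterval) (y : Bool) (t : unitInterval) :
    respProb f y t ≤ 1 := by
  cases y
  · simpa [respProb] using (f t).2.1
  · simpa [respProb] using (f t).2.2

theorem measurable_respProb {f : unitInterval → unitInterval} (hf : Measurable f) (y : Bool) :
    Measurable (respProb f y) := by
  have : Measurable fun t => (f t : ℝ) := hf.subtype_val
  unfold respProb
  cases y
  · simpa using this.const_sub 1
  · simpa using this

theorem integrable_respProb {f : unitInterval → unitInterval} (hf : Measurable f) (y : Bool) :
    Integrable (respProb f y) :=
  Integrable.of_bound (measurable_respProb hf y).aestronglyMeasurable 1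
    (Filter.Eventually.of_forall fun t => by
      rw [Real.norm_of_nonneg (respProb_nonneg f y t)]
      exact respProb_le_one f y t)

theorem mass_nonneg (f : unitInterval → unitInterval) (J : Set unitInterval) (y : Bool) :
    0 ≤ mass f J y :=
  integral_nonneg fun t => respProb_nonneg f y t

theorem mass_true_add_mass_false {f : unitInterval → unitInterval} (hf : Measurable f)
    (J : Set unitInterval) : mass f J true + mass f J false = volume.real J := by
  unfold mass
  rw [← integral_add (integrable_respProb hf _).integrableOn
    (integrable_respProb hf _).integrableOn]
  simp [respProb]

theorem sum_mass_inter_fiber {ι : Type*} [Fintype ι] [MeasurableSpace ι]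
    [MeasurableSingletonClass ι] {f : unitInterval → unitInterval} (hf : Measurable f)
    {J : Set unitInterval} (hJ : MeasurableSet J) (y : Bool) {c : unitInterval → ι}
    (hc : Measurable c) :
    ∑ i, mass f (J ∩ {t | c t = i}) y = mass f J y := by
  unfold mass
  have hU : J = ⋃ i, J ∩ {t | c t = i} := by
    ext t
    simp
  conv_rhs => rw [hU]
  rw [integral_iUnion_fintype]
  · exact fun i => hJ.inter (hc (measurableSet_singleton i))
  · intro i j hij
    refine Set.disjoint_left.2 ?_
    rintro t ⟨_, hi⟩ ⟨_, hj⟩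
    exact hij (hi.symm.trans hj)
  · exact fun i => (integrable_respProb hf y).integrableOn

theorem monotone_cellIndex {m : ℕ} (u : Fin m → unitInterval) : Monotone (cellIndex u) := by
  intro s t hst
  refine Fin.mk_le_mk.2 (Finset.card_le_card fun j hj => ?_)
  simp only [Finset.mem_filter, Finset.mem_univ, true_and] at hj ⊢
  exact hj.trans_le hst

theorem measurable_cellIndex {m : ℕ} (u : Fin m → unitInterval) : Measurable (cellIndex u) :=
  (monotone_cellIndex u).measurable

/-- The index of `t` in the grid that divides `[0, 1]` into `M` blocks of length `1 / M`
(and the singleton `{1}`). -/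
def blockIndex (M : ℕ) (t : unitInterval) : Fin (M + 1) :=
  ⟨⌊(M : ℝ) * t⌋₊, Nat.lt_succ_of_le (Nat.floor_le_of_le
    (mul_le_of_le_one_right (Nat.cast_nonneg M) t.2.2))⟩

theorem monotone_blockIndex (M : ℕ) : Monotone (blockIndex M) := by
  intro s t hst
  refine Fin.mk_le_mk.2 (Nat.floor_le_floor ?_)
  exact mul_le_mul_of_nonneg_left hst (Nat.cast_nonneg M)

theorem measurable_blockIndex (M : ℕ) : Measurable (blockIndex M) :=
  (monotone_blockIndex M).measurable

/-- A block of the grid. -/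
def block (M : ℕ) (b : Fin (M + 1)) : Set unitInterval := {t | blockIndex M t = b}

theorem measurableSet_block (M : ℕ) (b : Fin (M + 1)) : MeasurableSet (block M b) :=
  measurable_blockIndex M (measurableSet_singleton b)

theorem measurableSet_cell {m : ℕ} (u : Fin m → unitInterval) (i : Fin (m + 1)) :
    MeasurableSet (cell u i) :=
  measurable_cellIndex u (measurableSet_singleton i)

theorem volume_block_le {M : ℕ} (hM : 0 < M) (b : Fin (M + 1)) :
    volume.real (block M b) ≤ 1 / M := by
  have hM' : (0 : ℝ) < M := by exact_mod_cast hM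
  have hsub : Subtype.val '' block M b ⊆ Set.Icc ((b : ℝ) / M) (((b : ℝ) + 1) / M) := by
    rintro _ ⟨t, ht, rfl⟩
    have hb : ⌊(M : ℝ) * t⌋₊ = (b : ℕ) := congrArg Fin.val ht
    have h1 := Nat.floor_le (mul_nonneg hM'.le t.2.1)
    have h2 := Nat.lt_floor_add_one ((M : ℝ) * t)
    rw [hb] at h1 h2
    constructor
    · rw [div_le_iff₀ hM']
      linarith
    · rw [le_div_iff₀ hM']
      linarith
  rw [Measure.real, unitInterval.volume_apply]
  refine ENNReal.toReal_le_of_le_ofReal (by positivity) ((measure_mono hsub).trans ?_)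
  rw [Real.volume_Icc]
  refine ENNReal.ofReal_le_ofReal (le_of_eq ?_)
  ring

/-- A block that contains no split point lies in a single cell. -/
theorem exists_cellIndex_eq_of_block {m M : ℕ} (u : Fin m → unitInterval) (b : Fin (M + 1))
    (hb : ∀ j, blockIndex M (u j) ≠ b) : ∃ i₀, ∀ t ∈ block M b, cellIndex u t = i₀ := by
  have key : ∀ s ∈ block M b, ∀ t ∈ block M b, s ≤ t → cellIndex u s = cellIndex u t := by
    intro s hs t ht hst
    have : (Finset.univ.filter fun j => u j < s) = Finset.univ.filter fun j => u j < t := by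
      ext j
      simp only [Finset.mem_filter, Finset.mem_univ, true_and]
      refine ⟨fun h => h.trans_le hst, fun h => ?_⟩
      by_contra hsj
      push Not at hsj
      refine hb j (le_antisymm ?_ ?_)
      · exact ht ▸ monotone_blockIndex M h.le
      · exact hs ▸ monotone_blockIndex M hsj
    simp [cellIndex, this]
  rcases (block M b).eq_empty_or_nonempty with h | ⟨s, hs⟩
  · exact ⟨0, by simp [h]⟩
  · refine ⟨cellIndex u s, fun t ht => ?_⟩
    rcases le_total s t with h | h
    · exact (key s hs t ht h).symm
    · exact key t ht s hs h

/-- Comparison of two nonnegative arrays through their column sums, when all but a few columns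
are supported by a single row. -/
theorem sum_abs_rowSum_sub_le {ι κ : Type*} [Fintype ι] [Fintype κ] [DecidableEq κ]
    (x a : ι → κ → ℝ) (hx : ∀ i b, 0 ≤ x i b) (ha : ∀ i b, 0 ≤ a i b) (B : Finset κ)
    (hB : ∀ b ∉ B, ∃ i₀, ∀ i, i ≠ i₀ → x i b = 0 ∧ a i b = 0) :
    ∑ i, |∑ b, x i b - ∑ b, a i b| ≤
      ∑ b, |∑ i, x i b - ∑ i, a i b| + 2 * ∑ b ∈ B, ∑ i, a i b := by
  calc ∑ i, |∑ b, x i b - ∑ b, a i b| ≤ ∑ i, ∑ b, |x i b - a i b| := by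
        refine Finset.sum_le_sum fun i _ => ?_
        rw [← Finset.sum_sub_distrib]
        exact Finset.abs_sum_le_sum_abs _ _
    _ = ∑ b, ∑ i, |x i b - a i b| := Finset.sum_comm
    _ ≤ ∑ b, (|∑ i, x i b - ∑ i, a i b| + if b ∈ B then 2 * ∑ i, a i b else 0) := by
        refine Finset.sum_le_sum fun b _ => ?_
        -- In a column of `B`, with column sums `x` and `a`, the left side is at most `x + a ≤ |x -
        -- a| + 2 a`. Any other column has one relevant row, and equality holds.
        split_ifs with hb
        · have h1 : ∑ i, |x i b - a i b| ≤ ∑ i, x i b + ∑ i, a i b := by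
            rw [← Finset.sum_add_distrib]
            refine Finset.sum_le_sum fun i _ => abs_le.2 ⟨?_, ?_⟩ <;>
              linarith [hx i b, ha i b]
          linarith [le_abs_self (∑ i, x i b - ∑ i, a i b)]
        · obtain ⟨i₀, h⟩ := hB b hb
          rw [Finset.sum_eq_single i₀ (fun i _ hi => by simp [h i hi]) (by simp),
            Finset.sum_eq_single i₀ (fun i _ hi => (h i hi).1) (by simp),
            Finset.sum_eq_single i₀ (fun i _ hi => (h i hi).2) (by simp), add_zero]
    _ = _ := by
        rw [Finset.sum_add_distrib, Finset.mul_sum, Finset.sum_ite_mem, Finset.univ_inter]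

/-- The total deviation of the empirical law from the true law on the grid with `M` blocks. -/
def gridDeviation (f : unitInterval → unitInterval) (M : ℕ) {n : ℕ}
    (d : Fin n → unitInterval × Bool) : ℝ :=
  ∑ y, ∑ b, |(respCount d (block M b) y : ℝ) / n - mass f (block M b) y|

/-- The total deviation of the empirical law from the true law on the cells of any partition with
`m` split points is controlled by the deviation on the grid. -/
theorem sum_cell_deviation_le {f : unitInterval → unitInterval} (hf : Measurable f) {M : ℕ}
    (hM : 0 < M) {m n : ℕ} (u : Fin m → unitInterval) (d : Fin n → unitInterval × Bool) :
    ∑ y, ∑ i, |(respCount d (cell u i) y : ℝ) / n - mass f (cell u i) y| ≤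
      gridDeviation f M d + 2 * (m / M) := by
  set B : Finset (Fin (M + 1)) := Finset.univ.image fun j => blockIndex M (u j) with hBdef
  have hy : ∀ y, ∑ i, |(respCount d (cell u i) y : ℝ) / n - mass f (cell u i) y| ≤
      ∑ b, |(respCount d (block M b) y : ℝ) / n - mass f (block M b) y| +
        2 * ∑ b ∈ B, mass f (block M b) y := by
    intro y
    have h := sum_abs_rowSum_sub_le
      (fun i b => (respCount d (cell u i ∩ block M b) y : ℝ) / n)
      (fun i b => mass f (cell u i ∩ block M b) y)
      (fun i b => by positivity) (fun i b => mass_nonneg f _ y) B ?_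
    · have e1 : ∀ i, ∑ b, (respCount d (cell u i ∩ block M b) y : ℝ) / n =
          (respCount d (cell u i) y : ℝ) / n := fun i => by
        rw [← Finset.sum_div]
        congr 1
        exact sum_respCount_inter_fiber d (cell u i) y (blockIndex M)
      have e2 : ∀ i, ∑ b, mass f (cell u i ∩ block M b) y = mass f (cell u i) y := fun i =>
        sum_mass_inter_fiber hf (measurableSet_cell u i) y (measurable_blockIndex M)
      have e3 : ∀ b, ∑ i, (respCount d (cell u i ∩ block M b) y : ℝ) / n =
          (respCount d (block M b) y : ℝ) / n := fun b => by
        rw [← Finset.sum_div]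
        congr 1
        simp_rw [Set.inter_comm _ (block M b)]
        exact sum_respCount_inter_fiber d (block M b) y (cellIndex u)
      have e4 : ∀ b, ∑ i, mass f (cell u i ∩ block M b) y = mass f (block M b) y := fun b => by
        simp_rw [Set.inter_comm _ (block M b)]
        exact sum_mass_inter_fiber hf (measurableSet_block M b) y (measurable_cellIndex u)
      simpa only [e1, e2, e3, e4] using h
    · intro b hb
      obtain ⟨i₀, hi₀⟩ := exists_cellIndex_eq_of_block u b fun j hj =>
        hb (Finset.mem_image.2 ⟨j, Finset.mem_univ j, hj⟩)
      refine ⟨i₀, fun i hi => ?_⟩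
      have : cell u i ∩ block M b = ∅ := by
        refine Set.eq_empty_of_forall_notMem ?_
        rintro t ⟨h1, h2⟩
        exact hi (h1.symm.trans (hi₀ t h2))
      rw [this]
      simp [mass, respCount]
  have hcard : (B.card : ℝ) ≤ m := by
    exact_mod_cast Finset.card_image_le.trans_eq (Finset.card_fin m)
  -- The two responses together give the volume of a block, so `1 / M` is paid once per block hit by
  -- a split point.
  have hmass : ∑ y, ∑ b ∈ B, mass f (block M b) y ≤ m / M := by
    rw [Finset.sum_comm]
    calc ∑ b ∈ B, ∑ y, mass f (block M b) y ≤ ∑ b ∈ B, (1 / M : ℝ) := by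
          refine Finset.sum_le_sum fun b _ => ?_
          rw [Fintype.sum_bool, mass_true_add_mass_false hf]
          exact volume_block_le hM b
      _ = B.card * (1 / M : ℝ) := by simp
      _ ≤ m * (1 / M : ℝ) := mul_le_mul_of_nonneg_right hcard (by positivity)
      _ = _ := by ring
  calc _ ≤ ∑ y, (∑ b, |(respCount d (block M b) y : ℝ) / n - mass f (block M b) y| +
        2 * ∑ b ∈ B, mass f (block M b) y) := Finset.sum_le_sum fun y _ => hy y
    _ = gridDeviation f M d + 2 * ∑ y, ∑ b ∈ B, mass f (block M b) y := by
        rw [Finset.sum_add_distrib, ← Finset.mul_sum]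
        rfl
    _ ≤ _ := by linarith

/-! ### Deterministic consequences of a small cell deviation. -/

section

variable {m n : ℕ}

theorem integral_comp_cellIndex (u : Fin m → unitInterval) (φ : Fin (m + 1) → ℝ) :
    ∫ t, φ (cellIndex u t) = ∑ i, volume.real (cell u i) * φ i := by
  have hm := measurable_cellIndex u
  have : IsProbabilityMeasure (Measure.map (cellIndex u) volume) :=
    Measure.isProbabilityMeasure_map hm.aemeasurable
  rw [← integral_map hm.aemeasurable (f := φ) (measurable_of_finite φ).aestronglyMeasurable,
    integral_fintype (.of_finite)]
  refine Finset.sum_congr rfl fun i _ => ?_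
  rw [map_measureReal_apply hm (measurableSet_singleton i), smul_eq_mul]
  rfl

/-- On null cells both sides are `0` by convention; such cells have weight zero in the integrals
below. -/
theorem cellAverage_eq (f : unitInterval → unitInterval) (u : Fin m → unitInterval)
    (t : unitInterval) :
    cellAverage f u t =
      mass f (cell u (cellIndex u t)) true / volume.real (cell u (cellIndex u t)) := by
  rw [cellAverage, setAverage_eq, smul_eq_mul, inv_mul_eq_div]
  simp [mass, respProb]

theorem entropy_cellAverage (f : unitInterval → unitInterval) (u : Fin m → unitInterval) :
    entropy (cellAverage f u) = ∑ i, volume.real (cell u i) *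
      Real.binEntropy (mass f (cell u i) true / volume.real (cell u i)) := by
  rw [entropy, ← integral_comp_cellIndex u fun i =>
    Real.binEntropy (mass f (cell u i) true / volume.real (cell u i))]
  simp_rw [cellAverage_eq]

theorem l1Dist_stepFunction_cellAverage (f : unitInterval → unitInterval)
    (u : Fin m → unitInterval) (w : Fin (m + 1) → unitInterval) :
    l1Dist (stepFunction u w) (cellAverage f u) = ∑ i, volume.real (cell u i) *
      |(w i : ℝ) - mass f (cell u i) true / volume.real (cell u i)| := by
  rw [l1Dist, ← integral_comp_cellIndex u fun i =>
    |(w i : ℝ) - mass f (cell u i) true / volume.real (cell u i)|]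
  simp_rw [cellAverage_eq, stepFunction]

/-- The binary entropy is Lipschitz up to an arbitrarily small error. -/
theorem exists_abs_binEntropy_sub_le {τ : ℝ} (hτ : 0 < τ) :
    ∃ C, 0 ≤ C ∧ ∀ s ∈ Set.Icc (0 : ℝ) 1, ∀ t ∈ Set.Icc (0 : ℝ) 1,
      |Real.binEntropy s - Real.binEntropy t| ≤ τ + C * |s - t| := by
  have huc := isCompact_Icc (a := (0 : ℝ)) (b := 1) |>.uniformContinuousOn_of_continuous
    Real.binEntropy_continuous.continuousOn
  obtain ⟨ρ, hρ, h⟩ := Metric.uniformContinuousOn_iff.1 huc τ hτ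
  have hl : 0 ≤ Real.log 2 := Real.log_nonneg (by norm_num)
  -- Entropy takes values in `[0, log 2]`, so this slope makes the bound trivial once `|s - t| ≥ ρ`;
  -- closer points use uniform continuity.
  refine ⟨Real.log 2 / ρ, by positivity, fun s hs t ht => ?_⟩
  rcases lt_or_ge |s - t| ρ with hst | hst
  · have := h s hs t ht hst
    rw [Real.dist_eq] at this
    have : 0 ≤ Real.log 2 / ρ * |s - t| := by positivity
    linarith
  · have h1 : Real.log 2 ≤ Real.log 2 / ρ * |s - t| := by
      rw [div_mul_eq_mul_div, le_div_iff₀ hρ]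
      exact mul_le_mul_of_nonneg_left hst hl
    have := Real.binEntropy_nonneg hs.1 hs.2
    have := Real.binEntropy_nonneg ht.1 ht.2
    have := Real.binEntropy_le_log_two (p := s)
    have := Real.binEntropy_le_log_two (p := t)
    rw [abs_le]
    constructor <;> linarith

/-- The weight `p` compensates for dividing by a possibly tiny cell volume, since `a - p x / q = (a
- x) + (x / q) (q - p)` with `x / q ≤ 1`. Zero denominators are harmless: they force zero
numerators. -/
theorem mul_abs_div_sub_div_le {p a q x : ℝ} (ha : 0 ≤ a) (hap : a ≤ p) (hx : 0 ≤ x)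
    (hxq : x ≤ q) : p * |a / p - x / q| ≤ |x - a| + |q - p| := by
  have hp : 0 ≤ p := ha.trans hap
  have hq : 0 ≤ q := hx.trans hxq
  rw [← abs_of_nonneg hp, ← abs_mul, abs_of_nonneg hp, mul_sub, mul_div_cancel_of_imp'
    (fun h => le_antisymm (h ▸ hap) ha)]
  have h2 : a - p * (x / q) = (a - x) + x / q * (q - p) := by
    rcases hq.eq_or_lt with h | h
    · have : x = 0 := le_antisymm (h ▸ hxq) hx
      simp [this]
    · field_simp
      ring
  rw [h2]
  refine (abs_add_le _ _).trans ?_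
  rw [abs_sub_comm a x, abs_mul, abs_of_nonneg (div_nonneg hx hq)]
  have := mul_le_mul_of_nonneg_right (div_le_one_of_le₀ hxq hq) (abs_nonneg (q - p))
  linarith

/-- The error `τ * p` is proportional to the cell volume, so over all cells it adds up to `τ` only,
however many cells there are. -/
theorem abs_perspective_binEntropy_sub_le {τ C : ℝ} (hC : 0 ≤ C)
    (h : ∀ s ∈ Set.Icc (0 : ℝ) 1, ∀ t ∈ Set.Icc (0 : ℝ) 1,
      |Real.binEntropy s - Real.binEntropy t| ≤ τ + C * |s - t|)
    {p a q x : ℝ} (ha : 0 ≤ a) (hap : a ≤ p) (hx : 0 ≤ x) (hxq : x ≤ q) :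
    |p * Real.binEntropy (a / p) - q * Real.binEntropy (x / q)| ≤
      τ * p + (C + 1) * (|x - a| + |q - p|) := by
  have hp : 0 ≤ p := ha.trans hap
  have hq : 0 ≤ q := hx.trans hxq
  have hap' : a / p ∈ Set.Icc (0 : ℝ) 1 := ⟨by positivity, div_le_one_of_le₀ hap hp⟩
  have hxq' : x / q ∈ Set.Icc (0 : ℝ) 1 := ⟨by positivity, div_le_one_of_le₀ hxq hq⟩
  have h1 := mul_le_mul_of_nonneg_left (h _ hap' _ hxq') hp
  have h2 := mul_abs_div_sub_div_le ha hap hx hxq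
  have h3 : |Real.binEntropy (x / q)| ≤ 1 := by
    rw [abs_of_nonneg (Real.binEntropy_nonneg hxq'.1 hxq'.2)]
    exact Real.binEntropy_le_log_two.trans (by linarith [Real.log_two_lt_d9])
  calc |p * Real.binEntropy (a / p) - q * Real.binEntropy (x / q)|
      = |p * (Real.binEntropy (a / p) - Real.binEntropy (x / q)) +
          (p - q) * Real.binEntropy (x / q)| := by ring_nf
    _ ≤ p * |Real.binEntropy (a / p) - Real.binEntropy (x / q)| +
          |q - p| * |Real.binEntropy (x / q)| := by
        refine (abs_add_le _ _).trans_eq ?_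
        rw [abs_mul, abs_mul, abs_of_nonneg hp, abs_sub_comm p q]
    _ ≤ p * (τ + C * |a / p - x / q|) + |q - p| * 1 :=
        add_le_add h1 (mul_le_mul_of_nonneg_left h3 (abs_nonneg _))
    _ = τ * p + C * (p * |a / p - x / q|) + |q - p| := by ring
    _ ≤ τ * p + C * (|x - a| + |q - p|) + (|x - a| + |q - p|) := by
        have := mul_le_mul_of_nonneg_left h2 hC
        linarith [abs_nonneg (x - a)]
    _ = _ := by ring

/-- Summed over the cells, the slopes give `c n` and the constants `(m + 1) * -log c`, which is
small against `n` once `m / n` is small for fixed `c`. -/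
theorem log_add_one_le {c N : ℝ} (hc : 0 < c) (hc1 : c ≤ 1) (hN : 0 ≤ N) :
    Real.log (N + 1) ≤ c * N - Real.log c := by
  have h1 : 0 < c * (N + 1) := by positivity
  have h2 := Real.log_le_sub_one_of_pos h1
  rw [Real.log_mul hc.ne' (by positivity)] at h2
  linarith

/-- The deviation of the empirical law from the true law on the cells of a partition. -/
def cellDeviation (f : unitInterval → unitInterval) (u : Fin m → unitInterval)
    (d : Fin n → unitInterval × Bool) : ℝ :=
  ∑ y, ∑ i, |(respCount d (cell u i) y : ℝ) / n - mass f (cell u i) y|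

theorem cellDeviation_eq (f : unitInterval → unitInterval) (u : Fin m → unitInterval)
    (d : Fin n → unitInterval × Bool) :
    cellDeviation f u d =
      ∑ i, |(respCount d (cell u i) true : ℝ) / n - mass f (cell u i) true| +
      ∑ i, |(respCount d (cell u i) false : ℝ) / n - mass f (cell u i) false| := by
  rw [cellDeviation, Fintype.sum_bool]

theorem sum_abs_count_sub_volume_le {f : unitInterval → unitInterval} (hf : Measurable f)
    (u : Fin m → unitInterval) (d : Fin n → unitInterval × Bool) :
    ∑ i, |((respCount d (cell u i) true + respCount d (cell u i) false : ℕ) : ℝ) / n -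
      volume.real (cell u i)| ≤ cellDeviation f u d := by
  rw [cellDeviation_eq, ← Finset.sum_add_distrib]
  refine Finset.sum_le_sum fun i _ => ?_
  rw [← mass_true_add_mass_false hf]
  refine le_of_eq_of_le ?_ (abs_add_le _ _)
  push_cast
  ring_nf

theorem sum_abs_success_sub_mass_le (f : unitInterval → unitInterval)
    (u : Fin m → unitInterval) (d : Fin n → unitInterval × Bool) :
    ∑ i, |(respCount d (cell u i) true : ℝ) / n - mass f (cell u i) true| ≤
      cellDeviation f u d := by
  rw [cellDeviation_eq]
  exact le_add_of_nonneg_right (Finset.sum_nonneg fun i _ => abs_nonneg _)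

theorem mass_true_le_volume {f : unitInterval → unitInterval} (hf : Measurable f)
    (J : Set unitInterval) : mass f J true ≤ volume.real J := by
  rw [← mass_true_add_mass_false hf]
  exact le_add_of_nonneg_right (mass_nonneg f J false)

theorem sum_volume_cell (u : Fin m → unitInterval) : ∑ i, volume.real (cell u i) = 1 := by
  have := integral_comp_cellIndex u fun _ => (1 : ℝ)
  simpa using this.symm

/-- The normalized log-predictive probability is close to minus the entropy of the averaged
regression function. -/
theorem abs_log_predictive_add_entropy_le {f : unitInterval → unitInterval} (hf : Measurable f)
    {τ C c : ℝ} (hC : 0 ≤ C) (hc : 0 < c) (hc1 : c ≤ 1)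
    (h : ∀ s ∈ Set.Icc (0 : ℝ) 1, ∀ t ∈ Set.Icc (0 : ℝ) 1,
      |Real.binEntropy s - Real.binEntropy t| ≤ τ + C * |s - t|)
    (hn : 0 < n) (u : Fin m → unitInterval) (d : Fin n → unitInterval × Bool) :
    |(n : ℝ)⁻¹ * Real.log (predictive u d) + entropy (cellAverage f u)| ≤
      τ + 2 * (C + 1) * cellDeviation f u d + c + (m + 1) / n * -Real.log c := by
  set S : Fin (m + 1) → ℕ := fun i => respCount d (cell u i) true with hS
  set N : Fin (m + 1) → ℕ :=
    fun i => respCount d (cell u i) true + respCount d (cell u i) false with hN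
  have hn' : (0 : ℝ) < n := by exact_mod_cast hn
  have h1 := abs_log_predictive_add_le u d S N (fun _ => rfl) (fun _ => rfl)
  have hsumN : ∑ i, (N i : ℝ) = n := sum_cell_counts u d
  have h2 : ∑ i, Real.log ((N i : ℝ) + 1) ≤ c * n + (m + 1) * -Real.log c := by
    refine (Finset.sum_le_sum fun i _ => log_add_one_le hc hc1 (Nat.cast_nonneg (N i))).trans_eq ?_
    rw [Finset.sum_sub_distrib, ← Finset.mul_sum, hsumN]
    simp
    ring
  have h3 : |∑ i, volume.real (cell u i) *
        Real.binEntropy (mass f (cell u i) true / volume.real (cell u i)) -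
      (n : ℝ)⁻¹ * ∑ i, (N i : ℝ) * Real.binEntropy (S i / N i)| ≤
      τ + 2 * (C + 1) * cellDeviation f u d := by
    rw [Finset.mul_sum, ← Finset.sum_sub_distrib]
    have hterm : ∀ i, |volume.real (cell u i) *
        Real.binEntropy (mass f (cell u i) true / volume.real (cell u i)) -
        (n : ℝ)⁻¹ * ((N i : ℝ) * Real.binEntropy (S i / N i))| ≤
        τ * volume.real (cell u i) + (C + 1) * (|(S i : ℝ) / n - mass f (cell u i) true| +
          |(N i : ℝ) / n - volume.real (cell u i)|) := by
      intro i
      have hSN : (S i : ℝ) ≤ N i := by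
        exact_mod_cast Nat.le_add_right _ _
      have := abs_perspective_binEntropy_sub_le hC h (mass_nonneg f (cell u i) true)
        (mass_true_le_volume hf (cell u i)) (x := (S i : ℝ) / n) (q := (N i : ℝ) / n)
        (by positivity) (by gcongr)
      rwa [div_div_div_cancel_right₀ hn'.ne', div_eq_inv_mul (N i : ℝ) (n : ℝ), mul_assoc,
        ← div_eq_inv_mul (N i : ℝ) (n : ℝ)] at this
    refine (Finset.abs_sum_le_sum_abs _ _).trans ((Finset.sum_le_sum fun i _ => hterm i).trans ?_)
    rw [Finset.sum_add_distrib, ← Finset.mul_sum, ← Finset.mul_sum, Finset.sum_add_distrib,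
      sum_volume_cell, mul_one]
    have e1 := sum_abs_success_sub_mass_le f u d
    have e2 := sum_abs_count_sub_volume_le hf u d
    have e3 := mul_le_mul_of_nonneg_left (add_le_add e1 e2) (by linarith : 0 ≤ C + 1)
    linarith
  rw [entropy_cellAverage]
  have h4 : |(n : ℝ)⁻¹ * (Real.log (predictive u d) +
      ∑ i, (N i : ℝ) * Real.binEntropy (S i / N i))| ≤ c + (m + 1) / n * -Real.log c := by
    rw [abs_mul, abs_of_pos (inv_pos.2 hn')]
    refine (mul_le_mul_of_nonneg_left (h1.trans h2) (by positivity)).trans_eq ?_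
    field_simp
  have h5 := abs_add_le ((n : ℝ)⁻¹ * (Real.log (predictive u d) +
      ∑ i, (N i : ℝ) * Real.binEntropy (S i / N i)))
    (∑ i, volume.real (cell u i) *
        Real.binEntropy (mass f (cell u i) true / volume.real (cell u i)) -
      (n : ℝ)⁻¹ * ∑ i, (N i : ℝ) * Real.binEntropy (S i / N i))
  rw [show ∀ A B D : ℝ, (n : ℝ)⁻¹ * (A + B) + (D - (n : ℝ)⁻¹ * B) = (n : ℝ)⁻¹ * A + D by
    intros; ring] at h5
  linarith

/-- The `L¹` distance of a step function from the averaged regression function, in terms of the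
squared deviations of its heights. -/
theorem l1Dist_stepFunction_cellAverage_le {f : unitInterval → unitInterval} (hf : Measurable f)
    {c : ℝ} (hc : 0 < c) (hn : 0 < n) (u : Fin m → unitInterval)
    (d : Fin n → unitInterval × Bool) (w : Fin (m + 1) → unitInterval) :
    l1Dist (stepFunction u w) (cellAverage f u) ≤
      2 * cellDeviation f u d + (c * (m + 1) + sqDeviation u d w / c) / n := by
  have hn' : (0 : ℝ) < n := by exact_mod_cast hn
  rw [l1Dist_stepFunction_cellAverage]
  have hterm : ∀ i, volume.real (cell u i) *
      |(w i : ℝ) - mass f (cell u i) true / volume.real (cell u i)| ≤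
      |((respCount d (cell u i) true + respCount d (cell u i) false : ℕ) : ℝ) / n -
        volume.real (cell u i)| +
      |(respCount d (cell u i) true : ℝ) / n - mass f (cell u i) true| +
      (c + (((respCount d (cell u i) true + respCount d (cell u i) false : ℕ) : ℝ) * w i -
        respCount d (cell u i) true) ^ 2 / c) / n := by
    intro i
    generalize hNi : ((respCount d (cell u i) true + respCount d (cell u i) false : ℕ) : ℝ) = N
    generalize hSi : (respCount d (cell u i) true : ℝ) = S
    have hap := mass_true_le_volume hf (cell u i)
    have ha := mass_nonneg f (cell u i) true
    generalize mass f (cell u i) true = a at *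
    generalize volume.real (cell u i) = p at *
    have hp : 0 ≤ p := ha.trans hap
    have hw0 := (w i).2.1
    have hw1 := (w i).2.2
    generalize ((w i : unitInterval) : ℝ) = v at *
    have e1 : p * |v - a / p| = |p * v - a| := by
      rw [← abs_of_nonneg hp, ← abs_mul, abs_of_nonneg hp, mul_sub, mul_div_cancel_of_imp'
        (fun h => le_antisymm (h ▸ hap) ha)]
    -- This stands in for the Cauchy–Schwarz inequality over the cells, with the parameter `c`
    -- chosen later.
    have e2 : |N * v - S| ≤ c + (N * v - S) ^ 2 / c := by
      have hs := sq_abs (N * v - S)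
      generalize |N * v - S| = z at *
      rw [← hs, ← sub_nonneg,
        show c + z ^ 2 / c - z = ((z - c) ^ 2 + c * z) / c by field_simp; ring]
      rcases le_total 0 z with hz | hz
      · positivity
      · refine div_nonneg ?_ hc.le
        nlinarith [sq_nonneg (z + c), sq_nonneg z, sq_nonneg c]
    -- The first two terms are sampling errors of the cell; the last is the posterior fluctuation.
    have e3 : p * v - a = (-(v * (N / n - p)) + (S / n - a)) + (N * v - S) / n := by
      field_simp
      ring
    rw [e1, e3]
    refine (abs_add_le _ _).trans (add_le_add ((abs_add_le _ _).trans (add_le_add ?_ le_rfl)) ?_)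
    · rw [abs_neg, abs_mul, abs_of_nonneg hw0]
      exact mul_le_of_le_one_left (abs_nonneg _) hw1
    · rw [abs_div, abs_of_pos hn']
      gcongr
  refine (Finset.sum_le_sum fun i _ => hterm i).trans ?_
  rw [Finset.sum_add_distrib, Finset.sum_add_distrib, ← Finset.sum_div, Finset.sum_add_distrib,
    ← Finset.sum_div, ← sqDeviation]
  have e1 := sum_abs_success_sub_mass_le f u d
  have e2 := sum_abs_count_sub_volume_le hf u d
  simp only [Finset.sum_const, Finset.card_univ, Fintype.card_fin, nsmul_eq_mul]
  rw [show ((m + 1 : ℕ) : ℝ) * c = c * (m + 1) by push_cast; ring]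
  linarith

end

/-! ### Probability: empirical frequencies on the grid. -/

section

variable {Ω : Type*} [MeasurableSpace Ω] {P : Measure Ω}
  {f : unitInterval → unitInterval} {X : ℕ → Ω → unitInterval} {Y : ℕ → Ω → Bool}

/-- The event that the `k`-th pair has covariate in `J` and response `y`. -/
def pairEvent (X : ℕ → Ω → unitInterval) (Y : ℕ → Ω → Bool) (J : Set unitInterval) (y : Bool)
    (k : ℕ) : Set Ω :=
  {ω | X k ω ∈ J ∧ Y k ω = y}

theorem measurableSet_pairEvent (h : IsDataStream P f X Y) {J : Set unitInterval}
    (hJ : MeasurableSet J) (y : Bool) (k : ℕ) : MeasurableSet (pairEvent X Y J y k) :=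
  (h.measurable_X k hJ).inter (h.measurable_Y k (measurableSet_singleton y))

theorem measureReal_pairEvent_true [IsProbabilityMeasure P]
    (h : IsDataStream P f X Y) (hf : Measurable f)
    {J : Set unitInterval} (hJ : MeasurableSet J) (k : ℕ) :
    P.real (pairEvent X Y J true k) = mass f J true := by
  have hX := h.measurable_X k
  have hYs : MeasurableSet {ω | Y k ω = true} := h.measurable_Y k (measurableSet_singleton true)
  have hle : MeasurableSpace.comap (X k) inferInstance ≤ (inferInstance : MeasurableSpace Ω) :=
    hX.comap_le
  have e : (fun ω => if Y k ω = true then (1 : ℝ) else 0) =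
      Set.indicator {ω | Y k ω = true} fun _ => (1 : ℝ) := by
    ext ω
    simp [Set.indicator]
  have hint : Integrable (fun ω => if Y k ω = true then (1 : ℝ) else 0) P := by
    rw [e]
    exact (integrable_const _).indicator hYs
  have h1 : ∫ ω in X k ⁻¹' J, (if Y k ω = true then (1 : ℝ) else 0) ∂P =
      P.real (pairEvent X Y J true k) := by
    rw [e, setIntegral_indicator hYs]
    simp
    rfl
  have h2 := setIntegral_condExp hle hint (s := X k ⁻¹' J) ⟨J, hJ, rfl⟩
  rw [← h1, ← h2, setIntegral_congr_ae (g := fun ω => (f (X k ω) : ℝ)) (hX hJ)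
    ((h.bernoulli k).mono fun ω hω _ => hω), mass, ← h.uniform k,
    setIntegral_map hJ (measurable_respProb hf true).aestronglyMeasurable hX.aemeasurable]
  simp [respProb]

theorem measureReal_pairEvent [IsProbabilityMeasure P]
    (h : IsDataStream P f X Y) (hf : Measurable f)
    {J : Set unitInterval} (hJ : MeasurableSet J) (y : Bool) (k : ℕ) :
    P.real (pairEvent X Y J y k) = mass f J y := by
  have ht := measureReal_pairEvent_true h hf hJ k
  cases y
  · have h1 : P.real (pairEvent X Y J true k) + P.real (pairEvent X Y J false k) =
        P.real (X k ⁻¹' J) := by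
      rw [← measureReal_union _ (measurableSet_pairEvent h hJ false k)]
      · congr 1
        ext ω
        simp only [pairEvent, Set.mem_union, Set.mem_ofPred_eq, Set.mem_preimage]
        cases Y k ω <;> simp
      · refine Set.disjoint_left.2 ?_
        rintro ω ⟨_, h1⟩ ⟨_, h2⟩
        simp [h1] at h2
    have h2 : P.real (X k ⁻¹' J) = volume.real J := by
      rw [← h.uniform k, map_measureReal_apply (h.measurable_X k) hJ]
    rw [h2, ← mass_true_add_mass_false hf, ht] at h1
    linarith
  · exact ht

theorem respCount_firstData {Ω : Type*} (X : ℕ → Ω → unitInterval) (Y : ℕ → Ω → Bool) (n : ℕ)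
    (J : Set unitInterval) (y : Bool) (ω : Ω) :
    (respCount (firstData X Y n ω) J y : ℝ) =
      ∑ k : Fin n, (pairEvent X Y J y k).indicator (fun _ => (1 : ℝ)) ω := by
  classical
  rw [respCount_eq_sum]
  refine Finset.sum_congr rfl fun k _ => ?_
  simp only [Set.indicator_apply, firstData, pairEvent, Set.mem_ofPred_eq]
  congr

theorem measurable_respCount_firstData (h : IsDataStream P f X Y) (n : ℕ) {J : Set unitInterval}
    (hJ : MeasurableSet J) (y : Bool) :
    Measurable fun ω => (respCount (firstData X Y n ω) J y : ℝ) := by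
  simp_rw [respCount_firstData]
  exact Finset.measurable_sum _ fun k _ =>
    measurable_const.indicator (measurableSet_pairEvent h hJ y k)

theorem memLp_indicator_pairEvent [IsProbabilityMeasure P]
    (h : IsDataStream P f X Y) {J : Set unitInterval}
    (hJ : MeasurableSet J) (y : Bool) (k : ℕ) :
    MemLp ((pairEvent X Y J y k).indicator fun _ => (1 : ℝ)) 2 P :=
  (memLp_const 1).indicator (measurableSet_pairEvent h hJ y k)

/-- Variances add by pairwise independence, and an indicator's second moment is its mean. Keeping
the mass in the bound matters: over all blocks the masses sum to `1`. -/
theorem variance_respCount_le [IsProbabilityMeasure P]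
    (h : IsDataStream P f X Y) (hf : Measurable f) (n : ℕ)
    {J : Set unitInterval} (hJ : MeasurableSet J) (y : Bool) :
    ∫ ω, ((respCount (firstData X Y n ω) J y : ℝ) - n * mass f J y) ^ 2 ∂P ≤ n * mass f J y := by
  set Z : Fin n → Ω → ℝ := fun k => (pairEvent X Y J y k).indicator fun _ => (1 : ℝ) with hZ
  have hL : ∀ k, MemLp (Z k) 2 P := fun k => memLp_indicator_pairEvent h hJ y k
  have hmean : ∀ k, ∫ ω, Z k ω ∂P = mass f J y := fun k => by
    rw [hZ, integral_indicator_const _ (measurableSet_pairEvent h hJ y k),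
      measureReal_pairEvent h hf hJ y k]
    simp
  have hsum : ∫ ω, (∑ k, Z k) ω ∂P = n * mass f J y := by
    simp_rw [Finset.sum_apply]
    rw [integral_finsetSum _ fun k _ => (hL k).integrable (by norm_num)]
    simp [hmean]
  have hindep : Set.Pairwise (↑(Finset.univ : Finset (Fin n)))
      fun i j => IndepFun (Z i) (Z j) P := by
    intro i _ j _ hij
    have hp := h.indep.indepFun (i := (i : ℕ)) (j := (j : ℕ)) fun h => hij (Fin.ext h)
    have hφ : Measurable ((J ×ˢ {y} : Set (unitInterval × Bool)).indicator fun _ => (1 : ℝ)) :=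
      measurable_const.indicator (hJ.prod (measurableSet_singleton y))
    exact hp.comp hφ hφ
  have hvar : Var[∑ k, Z k; P] ≤ n * mass f J y := by
    rw [IndepFun.variance_sum (fun k _ => hL k) hindep]
    calc ∑ k, Var[Z k; P] ≤ ∑ _k : Fin n, mass f J y := by
          refine Finset.sum_le_sum fun k _ => ?_
          refine (variance_le_expectation_sq (hL k).aestronglyMeasurable).trans_eq ?_
          rw [← hmean k]
          refine integral_congr_ae (Filter.Eventually.of_forall fun ω => ?_)
          by_cases hω : ω ∈ pairEvent X Y J y k <;> simp [hZ, hω]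
      _ = _ := by simp
  rw [variance_eq_integral (Finset.aemeasurable_sum _ fun k _ => (hL k).aemeasurable), hsum] at hvar
  refine le_of_eq_of_le ?_ hvar
  refine integral_congr_ae (Filter.Eventually.of_forall fun ω => ?_)
  simp only [respCount_firstData, Finset.sum_apply, hZ]

theorem respCount_le {n : ℕ} (d : Fin n → unitInterval × Bool) (J : Set unitInterval) (y : Bool) :
    respCount d J y ≤ n := by
  classical
  exact (Finset.card_filter_le _ _).trans_eq (Finset.card_fin n)

theorem memLp_respCount_firstData_sub [IsProbabilityMeasure P]
    (h : IsDataStream P f X Y) (n : ℕ) {J : Set unitInterval}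
    (hJ : MeasurableSet J) (y : Bool) (x : ℝ) :
    MemLp (fun ω => (respCount (firstData X Y n ω) J y : ℝ) - x) 2 P := by
  refine MemLp.sub ?_ (memLp_const x)
  refine MemLp.of_bound (measurable_respCount_firstData h n hJ y).aestronglyMeasurable (n : ℝ)
    (Filter.Eventually.of_forall fun ω => ?_)
  rw [Real.norm_of_nonneg (Nat.cast_nonneg _)]
  exact_mod_cast respCount_le _ J y

theorem measurable_gridDeviation (h : IsDataStream P f X Y) (M n : ℕ) :
    Measurable fun ω => gridDeviation f M (firstData X Y n ω) := by
  unfold gridDeviation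
  refine Finset.measurable_sum _ fun y _ => Finset.measurable_sum _ fun b _ => ?_
  have := measurable_respCount_firstData h n (measurableSet_block M b) y
  fun_prop

theorem integrable_abs_respCount_sub [IsProbabilityMeasure P]
    (h : IsDataStream P f X Y) (M n : ℕ) (y : Bool)
    (b : Fin (M + 1)) :
    Integrable (fun ω => |(respCount (firstData X Y n ω) (block M b) y : ℝ) / n -
      mass f (block M b) y|) P := by
  have h1 := (memLp_respCount_firstData_sub h n (measurableSet_block M b) y 0).integrable
    (by norm_num)
  simp only [sub_zero] at h1
  exact ((h1.div_const _).sub (integrable_const _)).abs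

theorem integral_abs_respCount_sub_le [IsProbabilityMeasure P]
    (h : IsDataStream P f X Y) (hf : Measurable f) {n : ℕ}
    (hn : 0 < n) {J : Set unitInterval} (hJ : MeasurableSet J) (y : Bool) {c : ℝ} (hc : 0 < c) :
    ∫ ω, |(respCount (firstData X Y n ω) J y : ℝ) / n - mass f J y| ∂P ≤
      c + mass f J y / (n * c) := by
  have hn' : (0 : ℝ) < n := by exact_mod_cast hn
  have hL := (memLp_respCount_firstData_sub h n hJ y (n * mass f J y)).integrable_sq
  have hpt : ∀ ω, |(respCount (firstData X Y n ω) J y : ℝ) / n - mass f J y| ≤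
      c + ((respCount (firstData X Y n ω) J y : ℝ) - n * mass f J y) ^ 2 / (n ^ 2 * c) := by
    intro ω
    generalize (respCount (firstData X Y n ω) J y : ℝ) = r
    generalize mass f J y = a
    have e : (r - n * a) ^ 2 / (n ^ 2 * c) = (r / n - a) ^ 2 / c := by
      field_simp
    rw [e, ← sq_abs (r / n - a)]
    have hz := abs_nonneg (r / n - a)
    generalize |r / n - a| = z at *
    rw [← sub_nonneg, show c + z ^ 2 / c - z = ((z - c) ^ 2 + c * z) / c by field_simp; ring]
    positivity
  calc _ ≤ ∫ ω, (c + ((respCount (firstData X Y n ω) J y : ℝ) - n * mass f J y) ^ 2 /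
          (n ^ 2 * c)) ∂P :=
        integral_mono_of_nonneg (Filter.Eventually.of_forall fun _ => abs_nonneg _)
          ((integrable_const c).add (hL.div_const _)) (Filter.Eventually.of_forall hpt)
    _ = c + (∫ ω, ((respCount (firstData X Y n ω) J y : ℝ) - n * mass f J y) ^ 2 ∂P) /
          (n ^ 2 * c) := by
        rw [integral_add (integrable_const c) (hL.div_const _), integral_div]
        simp
    _ ≤ c + n * mass f J y / (n ^ 2 * c) := by
        gcongr
        exact variance_respCount_le h hf n hJ y
    _ = _ := by
        field_simp

theorem sum_mass_block (hf : Measurable f) (M : ℕ) : ∑ y, ∑ b, mass f (block M b) y = 1 := by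
  have h := fun y => sum_mass_inter_fiber hf MeasurableSet.univ y (measurable_blockIndex M)
  simp only [Set.univ_inter] at h
  have : ∑ y, ∑ b, mass f (block M b) y = ∑ y, mass f Set.univ y :=
    Finset.sum_congr rfl fun y _ => h y
  rw [this, Fintype.sum_bool, mass_true_add_mass_false hf]
  simp

theorem integral_gridDeviation_le [IsProbabilityMeasure P]
    (h : IsDataStream P f X Y) (hf : Measurable f) (M : ℕ) {n : ℕ}
    (hn : 0 < n) {c : ℝ} (hc : 0 < c) :
    ∫ ω, gridDeviation f M (firstData X Y n ω) ∂P ≤ 2 * (M + 1) * c + 1 / (n * c) := by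
  unfold gridDeviation
  rw [integral_finsetSum _ fun y _ => integrable_finsetSum _ fun b _ =>
    integrable_abs_respCount_sub h M n y b]
  calc _ = ∑ y, ∑ b, ∫ ω, |(respCount (firstData X Y n ω) (block M b) y : ℝ) / n -
            mass f (block M b) y| ∂P :=
        Finset.sum_congr rfl fun y _ => integral_finsetSum _ fun b _ =>
          integrable_abs_respCount_sub h M n y b
    _ ≤ ∑ y, ∑ b, (c + mass f (block M b) y / (n * c)) :=
        Finset.sum_le_sum fun y _ => Finset.sum_le_sum fun b _ =>
          integral_abs_respCount_sub_le h hf hn (measurableSet_block M b) y hc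
    _ = 2 * (M + 1) * c + (∑ y, ∑ b, mass f (block M b) y) / (n * c) := by
        simp only [Finset.sum_add_distrib, ← Finset.sum_div, Finset.sum_const, Finset.card_univ,
          Fintype.card_fin, Fintype.card_bool, nsmul_eq_mul]
        push_cast
        ring
    _ = _ := by rw [sum_mass_block hf]

/-- Markov's inequality for the deviation on the grid. -/
theorem one_sub_le_measure_gridDeviation_lt [IsProbabilityMeasure P]
    (h : IsDataStream P f X Y) (hf : Measurable f) (M : ℕ)
    {n : ℕ} (hn : 0 < n) {c η δ : ℝ} (hc : 0 < c) (hη : 0 < η)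
    (hδ : 2 * (M + 1) * c + 1 / (n * c) ≤ η * δ) :
    1 - ENNReal.ofReal δ ≤ P {ω | gridDeviation f M (firstData X Y n ω) < η} := by
  have hmeas : MeasurableSet {ω | gridDeviation f M (firstData X Y n ω) < η} :=
    measurableSet_lt (measurable_gridDeviation h M n) measurable_const
  have hint : Integrable (fun ω => gridDeviation f M (firstData X Y n ω)) P :=
    integrable_finsetSum _ fun y _ => integrable_finsetSum _ fun b _ =>
      integrable_abs_respCount_sub h M n y b
  have h1 := mul_meas_ge_le_integral_of_nonneg (Filter.Eventually.of_forall fun ω =>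
    (Finset.sum_nonneg fun y _ => Finset.sum_nonneg fun b _ => abs_nonneg _ :
      0 ≤ gridDeviation f M (firstData X Y n ω))) hint η
  have h2 := h1.trans ((integral_gridDeviation_le h hf M hn hc).trans hδ)
  have h3 : P.real {ω | η ≤ gridDeviation f M (firstData X Y n ω)} ≤ δ :=
    le_of_mul_le_mul_left h2 hη
  have h4 : P {ω | η ≤ gridDeviation f M (firstData X Y n ω)} ≤ ENNReal.ofReal δ := by
    rw [← ofReal_measureReal]
    exact ENNReal.ofReal_le_ofReal h3
  have h5 : {ω | gridDeviation f M (firstData X Y n ω) < η}ᶜ =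
      {ω | η ≤ gridDeviation f M (firstData X Y n ω)} := by
    ext ω
    simp
  rw [tsub_le_iff_right, ← prob_add_prob_compl (μ := P) hmeas, h5]
  gcongr

end

/-- The deviation on a grid whose number of blocks is a small fraction of the sample size is
small with high probability. -/
theorem exists_grid {Ω : Type*} [MeasurableSpace Ω] {P : Measure Ω} [IsProbabilityMeasure P]
    {f : unitInterval → unitInterval} (hf : Measurable f) {X : ℕ → Ω → unitInterval}
    {Y : ℕ → Ω → Bool} (h : IsDataStream P f X Y) {η δ : ℝ} (hη : 0 < η) (hδ : 0 < δ) :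
    ∃ γ : ℝ, 0 < γ ∧ ∃ n₀ : ℕ, ∀ n, n₀ ≤ n → ∃ M : ℕ, 0 < M ∧ γ * n ≤ M ∧
      1 - ENNReal.ofReal δ ≤ P {ω | gridDeviation f M (firstData X Y n ω) < η} := by
  -- Both terms of the mean bound should be at most `τ`. With cutoff `τ / (4 M)` the second is `4 M
  -- / (n τ)`; since `M < γ n + 1 ≤ 2 γ n`, it is at most `τ` for `γ = τ ^ 2 / 8`.
  set τ := η * δ / 2 with hτdef
  have hτ : 0 < τ := by positivity
  set γ := τ ^ 2 / 8 with hγdef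
  have hγ : 0 < γ := by positivity
  refine ⟨γ, hγ, ⌈1 / γ⌉₊, fun n hn => ?_⟩
  have hn1 : 1 ≤ γ * n := by
    have := (Nat.ceil_le.1 hn)
    rwa [div_le_iff₀ hγ, mul_comm] at this
  have hn' : (0 : ℝ) < n := by
    by_contra hneg
    have : (n : ℝ) = 0 := le_antisymm (not_lt.1 hneg) (Nat.cast_nonneg n)
    rw [this] at hn1
    linarith
  have hM1 := Nat.le_ceil (γ * n)
  have hM2 := Nat.ceil_lt_add_one (by positivity : 0 ≤ γ * n)
  have hM0 : 0 < ⌈γ * n⌉₊ := Nat.ceil_pos.2 (by positivity)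
  refine ⟨⌈γ * n⌉₊, hM0, hM1, ?_⟩
  generalize ⌈γ * (n : ℝ)⌉₊ = M at *
  have hM' : (1 : ℝ) ≤ M := by exact_mod_cast hM0
  refine one_sub_le_measure_gridDeviation_lt h hf M (by exact_mod_cast hn')
    (c := τ / (4 * M)) (by positivity) hη ?_
  have e1 : 2 * ((M : ℝ) + 1) * (τ / (4 * M)) ≤ τ := by
    rw [mul_div_assoc', div_le_iff₀ (by positivity)]
    nlinarith
  have e2 : 1 / ((n : ℝ) * (τ / (4 * M))) ≤ τ := by
    rw [div_le_iff₀ (by positivity), show τ * (n * (τ / (4 * M))) = τ ^ 2 * n / (4 * M) by ring,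
      le_div_iff₀ (by positivity)]
    have : τ ^ 2 = 8 * γ := by rw [hγdef]; ring
    rw [this]
    linarith
  have : η * δ = 2 * τ := by rw [hτdef]; ring
  linarith

/-! ### Choice of constants and conclusion. -/

/-- Posterior concentration for data whose empirical law is close to the true law on the cells. -/
theorem posterior_lt {m n : ℕ} {f : unitInterval → unitInterval} (hf : Measurable f) {δ : ℝ}
    (hδ : 0 < δ) (hn : 0 < n) (u : Fin m → unitInterval) (d : Fin n → unitInterval × Bool)
    (hdev : cellDeviation f u d ≤ δ / 16) (hmn : (m : ℝ) + 1 ≤ n)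
    (hm : 5 / δ ^ 2 * ((m : ℝ) + 1) ≤ δ / 8 * n) :
    posterior u d {g | δ ≤ l1Dist g (cellAverage f u)} < ENNReal.ofReal δ := by
  have hn' : (0 : ℝ) < n := by exact_mod_cast hn
  -- With threshold `δ c n / 2 = 5 n / (2 δ)` and `n + m + 1 ≤ 2 n`, Markov's inequality gives at
  -- most `4 δ / 5 < δ`.
  set c := 5 / δ ^ 2 with hc
  have hc0 : 0 < c := by positivity
  have hT : 0 < δ * c * n / 2 := by positivity
  have hsub : {w | stepFunction u w ∈ {g | δ ≤ l1Dist g (cellAverage f u)}} ⊆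
      {w | δ * c * n / 2 ≤ sqDeviation u d w} := by
    intro w hw
    have h1 : δ ≤ l1Dist (stepFunction u w) (cellAverage f u) := hw
    have h2 := l1Dist_stepFunction_cellAverage_le hf hc0 hn u d w
    have h3 : 3 / 4 * δ ≤ (c * (m + 1) + sqDeviation u d w / c) / n := by linarith
    rw [le_div_iff₀ hn'] at h3
    have h4 : δ / 2 * n ≤ sqDeviation u d w / c := by
      nlinarith [mul_pos hδ hn']
    rw [le_div_iff₀ hc0] at h4
    change δ * c * n / 2 ≤ sqDeviation u d w
    linarith
  refine (measure_mono hsub).trans_lt ((heightPosterior_sqDeviation_le u d hT).trans_lt ?_)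
  rw [ENNReal.ofReal_lt_ofReal_iff hδ, div_lt_iff₀ hT]
  have : δ * (δ * c * n / 2) = 5 / 2 * n := by
    rw [hc]
    field_simp
  rw [this]
  linarith

end BinaryRegression

end

theorem proposition3 {Ω : Type*} [MeasurableSpace Ω] (P : MeasureTheory.Measure Ω)
    [MeasureTheory.IsProbabilityMeasure P]
    (f : unitInterval → unitInterval) (hf : Measurable f)
    (X : ℕ → Ω → unitInterval) (Y : ℕ → Ω → Bool)
    (hXY : BinaryRegression.IsDataStream P f X Y) (δ : ℝ) (hδ : 0 < δ) :
    ∃ ε : ℝ, 0 < ε ∧ ∃ n₀ : ℕ, ∀ n : ℕ, n₀ ≤ n →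
      -- a measurable event of probability at least `1 - δ`, on which the assertions hold
      ∃ G : Set Ω, MeasurableSet G ∧ 1 - ENNReal.ofReal δ ≤ P G ∧
        ∀ ω ∈ G, ∀ m : ℕ, (m : ℝ) ≤ ε * n → ∀ u : Fin m → unitInterval,
          BinaryRegression.posterior u (BinaryRegression.firstData X Y n ω)
              {g | δ ≤ BinaryRegression.l1Dist g (BinaryRegression.cellAverage f u)}
            < ENNReal.ofReal δ ∧
          |(n : ℝ)⁻¹ * Real.log
                (BinaryRegression.predictive u (BinaryRegression.firstData X Y n ω))
              + BinaryRegression.entropy (BinaryRegression.cellAverage f u)| < δ := by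
  obtain ⟨C, hC, hmod⟩ := BinaryRegression.exists_abs_binEntropy_sub_le (by positivity : 0 < δ / 8)
  -- A cell deviation of at most `2 η` then costs at most `δ / 8` in the entropy estimate; its four
  -- error terms total at most `δ / 2`.
  set η := δ / (32 * (C + 1)) with hηdef
  have hη : 0 < η := by positivity
  have hηC : (C + 1) * η = δ / 32 := by
    rw [hηdef]
    field_simp
  have hηδ : η ≤ δ / 32 := by nlinarith
  obtain ⟨γ, hγ, n₁, hgrid⟩ := BinaryRegression.exists_grid hf hXY hη hδ
  set c := min 1 (δ / 8) with hcdef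
  have hc : 0 < c := by positivity
  have hc1 : c ≤ 1 := min_le_left _ _
  have hcδ : c ≤ δ / 8 := min_le_right _ _
  have hL : 0 ≤ -Real.log c := neg_nonneg.2 (Real.log_nonpos hc.le hc1)
  set L := -Real.log c with hLdef
  set K := 5 / δ ^ 2 with hKdef
  have hK : 0 < K := by positivity
  -- The four bounds serve, in order: `m + 1 ≤ n`, the logarithmic cost per cell, the smallness of
  -- `m + 1` in `posterior_lt`, and `2 m / M ≤ η`.
  set ε := min (min (1 / 2) (δ / (16 * (L + 1)))) (min (δ / (16 * K)) (η * γ / 2)) with hεdef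
  have hε : 0 < ε := by positivity
  have hε1 : ε ≤ 1 / 2 := (min_le_left _ _).trans (min_le_left _ _)
  have hε2 : ε * (L + 1) ≤ δ / 16 := by
    have : ε ≤ δ / (16 * (L + 1)) := (min_le_left _ _).trans (min_le_right _ _)
    rw [le_div_iff₀ (by positivity)] at this
    linarith
  have hε3 : ε * K ≤ δ / 16 := by
    have : ε ≤ δ / (16 * K) := (min_le_right _ _).trans (min_le_left _ _)
    rw [le_div_iff₀ (by positivity)] at this
    linarith
  have hε4 : ε ≤ η * γ / 2 := (min_le_right _ _).trans (min_le_right _ _)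
  refine ⟨ε, hε, max n₁ ⌈1 / ε⌉₊, fun n hn => ?_⟩
  obtain ⟨M, hM, hMn, hP⟩ := hgrid n ((le_max_left _ _).trans hn)
  have hεn : 1 ≤ ε * n := by
    have := Nat.ceil_le.1 ((le_max_right _ _).trans hn)
    rwa [div_le_iff₀ hε, mul_comm] at this
  have hn' : (0 : ℝ) < n := by
    by_contra hneg
    nlinarith
  have hn0 : 0 < n := by exact_mod_cast hn'
  -- The event is that the grid deviation is below `η`. It involves neither `m` nor `u`, so one
  -- event serves all partitions.
  refine ⟨_, measurableSet_lt (BinaryRegression.measurable_gridDeviation hXY M n)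
    measurable_const, hP, ?_⟩
  intro ω hω m hm u
  have hm1 : (m : ℝ) + 1 ≤ 2 * ε * n := by linarith
  have hdev : BinaryRegression.cellDeviation f u (BinaryRegression.firstData X Y n ω) ≤ 2 * η := by
    have h1 := BinaryRegression.sum_cell_deviation_le hf hM u (BinaryRegression.firstData X Y n ω)
    have h2 : BinaryRegression.gridDeviation f M (BinaryRegression.firstData X Y n ω) < η := hω
    have hM' : (0 : ℝ) < M := by exact_mod_cast hM
    have h3 : 2 * ((m : ℝ) / M) ≤ η := by
      rw [mul_div_assoc', div_le_iff₀ hM']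
      have e1 := mul_le_mul_of_nonneg_left hMn hη.le
      have e2 := mul_le_mul_of_nonneg_right hε4 hn'.le
      linarith
    exact h1.trans (by linarith)
  constructor
  · refine BinaryRegression.posterior_lt hf hδ hn0 u _ (by linarith) ?_ ?_
    · nlinarith
    · have e1 := mul_le_mul_of_nonneg_left hm1 hK.le
      have e2 := mul_le_mul_of_nonneg_right hε3 hn'.le
      linarith
  · refine (BinaryRegression.abs_log_predictive_add_entropy_le hf hC hc hc1 hmod hn0 u _).trans_lt ?_
    have e1 : ((m : ℝ) + 1) / n ≤ 2 * ε := (div_le_iff₀ hn').2 hm1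
    have e2 := mul_le_mul_of_nonneg_right e1 hL
    have e3 := mul_le_mul_of_nonneg_left hdev (by positivity : 0 ≤ 2 * (C + 1))
    nlinarith
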